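/- **Definitions.** A *monadic BL-chain* is a totally ordered BL-algebra $\langle A,\vee,\wedge,*,\to,0,1\rangle$ with two unary operations $\exists,\forall$ such that, for all $x,y\in A$: $\forall x\to x=1$; $\forall(x\to\forall y)=\exists x\to\forall y$; $\forall(\forall x\to y)=\forall x\to\forall y$; $\forall(\exists x\vee y)=\exists x\vee\forall y$; $\exists(x*x)=\exists x*\exists x$. A *monadic Heyting chain* is a totally ordered Heyting algebra $I$ with unary operations $\exists,\forall$ such that, for all $a,b\in I$: $\forall a\le a\le\exists a$; $\forall(a\wedge b)=\forall a\wedge\forall b$; $\exists(a\vee b)=\exists a\vee\exists b$; $\forall 1=1$; $\exists 0=0$; $\forall\exists a=\exists a$; $\exists\forall a=\forall a$; $\exists(\exists a\wedge b)=\exists a\wedge\exists b$. Its set of fixed elements is $\forall I=\{\forall i: i\in I\}$. A *Wajsberg hoop* is an algebra $\langle H,*,\to,1\rangle$ such that $\langle H,*,1\rangle$ is a commutative monoid and, for all $a,b,c\in H$: $a\to a=1$; $(a*b)\to c=a\to(b\to c)$; $a*(a\to b)=b*(b\to a)$; $(a\to b)\to b=(b\to a)\to a$. It is ordered by $a\le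 b\iff a\to b=1$. Let $I$ be a monadic Heyting chain with least element $0$ and greatest element $1$ (possibly $0=1$). Let $C_1=\{1\}$ and, for each $i\in I\setminus\{1\}$, let $C_i$ be a nonempty set with $1\notin C_i$ such that $\langle C_i\cup\{1\},*_i,\to_i,1\rangle$ is a totally ordered Wajsberg hoop. Assume that $C_0$ has a least element (also denoted $0$), that $C_{\forall i}$ has a greatest element $u_{\forall i}$ whenever $\forall i<i$, and that $C_{\exists i}$ has a least element $0_{\exists i}$ whenever $i<\exists i$. Then $\mathbf C_I$ is the algebra with universe $\{(i,a): i\in I,\ a\in C_i\}$, whose lattice operations are those of the lexicographic total order $$(i,a)\le(j,b)\iff i<j\ \text{ or }\ (i=j\text{ and }a\le b),$$ whose constants are $(0,0)$ and $(1,1)$, and whose remaining operations are $$(i,a)*(j,b)=\begin{cases}(i,a)&\text{if } i<j,\\(i,a*_ib)&\text{if } i=j,\\(j,b)&\text{if } i>j,\end{cases}\qquad (i,a)\to(j,b)=\begin{cases}(1,1)&\text{if }(i,a)\le(j,b),\\(i,a\to_ib)&\text{if } i=j\text{ and }a>b,\\(j,b)&\text{if } i>j,\end{cases}$$ $$\exists(i,a)=\begin{cases}(i,a)&\text{if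 } i\in\forall I,\\(\exists i,0_{\exists i})&\text{if } i\notin\forall I,\end{cases}\qquad \forall(i,a)=\begin{cases}(i,a)&\text{if } i\in\forall I,\\(\forall i,u_{\forall i})&\text{if } i\notin\forall I.\end{cases}$$ **Theorem.** For every monadic BL-chain $\mathbf A$ there are a monadic Heyting chain $I$ and a family $(C_i)_{i\in I}$ as above such that $\mathbf A$ is isomorphic to $\mathbf C_I$: there is a bijection from $A$ onto $\mathbf C_I$ that preserves $\vee,\wedge,*,\to,\exists,\forall,0,1$. -/

import Mathlib

universe u

/-- BL-algebras: the bottom and top of the bounded lattice are `0 = ⊥` and `1`,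
`*` is the monoid operation and `⇨` is its residual. -/
class BLAlgebra (A : Type u) extends Lattice A, BoundedOrder A, CommMonoid A, HImp A where
  one_eq_top : (1 : A) = ⊤
  residuation : ∀ x y z : A, x * z ≤ y ↔ z ≤ x ⇨ y
  divisibility : ∀ x y : A, x ⊓ y = x * (x ⇨ y)
  prelinearity : ∀ x y : A, (x ⇨ y) ⊔ (y ⇨ x) = 1

/-- Monadic BL-algebras; `qA` is the universal and `qE` the existential quantifier. -/
class MonadicBLAlgebra (A : Type u) extends BLAlgebra A where
  qE : A → A
  qA : A → A
  m1 : ∀ x, qA x ⇨ x = 1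
  m2 : ∀ x y, qA (x ⇨ qA y) = qE x ⇨ qA y
  m3 : ∀ x y, qA (qA x ⇨ y) = qA x ⇨ qA y
  m4 : ∀ x y, qA (qE x ⊔ y) = qE x ⊔ qA y
  m5 : ∀ x, qE (x * x) = qE x * qE x

/-- Totally ordered monadic BL-algebras. -/
class MonadicBLChain (A : Type u) extends MonadicBLAlgebra A where
  total : ∀ x y : A, x ≤ y ∨ y ≤ x

/-- Monadic Heyting algebras; `qA` is the universal and `qE` the existential quantifier. -/
class MonadicHeytingAlgebra (I : Type u) extends HeytingAlgebra I where
  qE : I → I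
  qA : I → I
  qA_le : ∀ a, qA a ≤ a
  le_qE : ∀ a, a ≤ qE a
  qA_inf : ∀ a b, qA (a ⊓ b) = qA a ⊓ qA b
  qE_sup : ∀ a b, qE (a ⊔ b) = qE a ⊔ qE b
  qA_top : qA ⊤ = ⊤
  qE_bot : qE ⊥ = ⊥
  qA_qE : ∀ a, qA (qE a) = qE a
  qE_qA : ∀ a, qE (qA a) = qA a
  qE_inf : ∀ a b, qE (qE a ⊓ b) = qE a ⊓ qE b

/-- Totally ordered monadic Heyting algebras. -/
class MonadicHeytingChain (I : Type u) extends MonadicHeytingAlgebra I where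
  total : ∀ i j : I, i ≤ j ∨ j ≤ i

/-- Totally ordered Wajsberg hoops.  The order is `a ≤ b ↔ a ⇨ b = 1`. -/
class WajsbergHoopChain (H : Type u) extends CommMonoid H, HImp H where
  himp_self : ∀ a : H, a ⇨ a = 1
  mul_himp : ∀ a b c : H, (a * b) ⇨ c = a ⇨ (b ⇨ c)
  div_comm : ∀ a b : H, a * (a ⇨ b) = b * (b ⇨ a)
  wajsberg : ∀ a b : H, (a ⇨ b) ⇨ b = (b ⇨ a) ⇨ a
  total : ∀ a b : H, a ⇨ b = 1 ∨ b ⇨ a = 1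

namespace WajsbergHoopChain

variable {H : Type u} [WajsbergHoopChain H]

theorem antisymm {a b : H} (h : a ⇨ b = 1) (h' : b ⇨ a = 1) : a = b := by
  have := div_comm a b
  rwa [h, h', mul_one, mul_one] at this

theorem one_himp (a : H) : (1 : H) ⇨ a = a := by
  apply antisymm
  · rw [← mul_one ((1 : H) ⇨ a), mul_himp, himp_self]
  · rw [← mul_himp, mul_one, himp_self]

theorem himp_one (a : H) : a ⇨ (1 : H) = 1 := by
  have h : a * (a ⇨ 1) = a := by rw [div_comm, one_mul, one_himp]
  calc a ⇨ (1 : H) = ((a ⇨ 1) * a) ⇨ 1 := by rw [mul_comm, h]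
    _ = 1 := by rw [mul_himp, himp_self]

theorem trans {a b c : H} (h : a ⇨ b = 1) (h' : b ⇨ c = 1) : a ⇨ c = 1 := by
  have h1 := div_comm a b
  rw [h, mul_one, mul_comm] at h1
  rw [h1, mul_himp, h', himp_one]

theorem left_eq_one {a b : H} (h : a * b = 1) : a = 1 := by
  have : (a * b) ⇨ a = 1 := by rw [mul_comm, mul_himp, himp_self, himp_one]
  rwa [h, one_himp] at this

/-- The order of the hoop, `a ≤ b ↔ a ⇨ b = 1`. -/
noncomputable instance : LinearOrder H where
  le a b := a ⇨ b = 1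
  le_refl := himp_self
  le_trans _ _ _ := trans
  le_antisymm _ _ := antisymm
  le_total := total
  toDecidableLE := Classical.decRel _

end WajsbergHoopChain

/-- `componentSet I H i` is the component `C_i` with `C_i ∪ {1} = H i`: it is `{1}` for the top
index (where the hoop is trivial), and `H i` without its unit for every other index. -/
def componentSet (I : Type u) [MonadicHeytingChain I] (H : I → Type u)
    [∀ i, WajsbergHoopChain (H i)] (i : I) : Set (H i) :=
  {a | i = ⊤ ∨ a ≠ 1}

/-- The data for the construction of `C_I`, for a monadic Heyting chain `I`: totally ordered
Wajsberg hoops `H i = C_i ∪ {1}`, where `C_⊤ = {1}`, the other `C_i` are nonempty and do not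
contain `1`, `C_⊥` has a least element, `C_{∀i}` has a greatest element if `∀i < i` and `C_{∃i}`
has a least element if `i < ∃i`. -/
structure HoopFamily (I : Type u) [MonadicHeytingChain I] where
  H : I → Type u
  [hoop : ∀ i, WajsbergHoopChain (H i)]
  subsingleton_top : Subsingleton (H ⊤)
  nonempty : ∀ i, (componentSet I H i).Nonempty
  exists_bot : ∃ z, IsLeast (componentSet I H ⊥) z
  exists_greatest : ∀ i : I, MonadicHeytingAlgebra.qA i < i →
    ∃ z, IsGreatest (componentSet I H (MonadicHeytingAlgebra.qA i)) z
  exists_least : ∀ i : I, i < MonadicHeytingAlgebra.qE i →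
    ∃ z, IsLeast (componentSet I H (MonadicHeytingAlgebra.qE i)) z

attribute [instance] HoopFamily.hoop

namespace HoopFamily

variable {I : Type u} [MonadicHeytingChain I]

open MonadicHeytingAlgebra

/-- The component `C_i` as a set of elements of `C_i ∪ {1}`. -/
abbrev C (S : HoopFamily I) (i : I) : Set (S.H i) := componentSet I S.H i

/-- The carrier of the ordinal sum `C_I`: the pairs `(i, a)` with `i ∈ I` and `a ∈ C_i`. -/
@[ext]
structure Sum (S : HoopFamily I) where
  idx : I
  val : S.H idx
  mem : val ∈ S.C idx

namespace Sum

variable {S : HoopFamily I}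

/-- `(i, a) ≤ (j, b)` iff `i < j`, or `i = j` and `a ≤ b`. -/
protected def Le (x y : S.Sum) : Prop :=
  x.idx < y.idx ∨ ∃ h : x.idx = y.idx, h ▸ x.val ≤ y.val

protected theorem le_antisymm' (x y : S.Sum) (h : Sum.Le x y) (h' : Sum.Le y x) : x = y := by
  obtain ⟨i, a, ha⟩ := x
  obtain ⟨j, b, hb⟩ := y
  rcases h with h | ⟨h, hle⟩
  · rcases h' with h' | ⟨h', -⟩
    · exact absurd h' (lt_asymm h)
    · exact absurd h'.symm h.ne
  · dsimp only at h
    subst h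
    rcases h' with h' | ⟨h', hle'⟩
    · exact absurd h' (lt_irrefl _)
    · simp only [Sum.mk.injEq, heq_eq_eq, true_and]
      exact le_antisymm hle hle'

protected theorem le_trans' (x y z : S.Sum) (h : Sum.Le x y) (h' : Sum.Le y z) :
    Sum.Le x z := by
  obtain ⟨i, a, ha⟩ := x
  obtain ⟨j, b, hb⟩ := y
  obtain ⟨k, c, hc⟩ := z
  rcases h with h | ⟨h, hle⟩
  · rcases h' with h' | ⟨h', -⟩
    · exact Or.inl (h.trans h')
    · exact Or.inl (h.trans_eq h')
  · dsimp only at h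
    subst h
    rcases h' with h' | ⟨h', hle'⟩
    · exact Or.inl h'
    · dsimp only at h'
      subst h'
      exact Or.inr ⟨rfl, le_trans hle hle'⟩

protected theorem le_total' (x y : S.Sum) : Sum.Le x y ∨ Sum.Le y x := by
  obtain ⟨i, a, ha⟩ := x
  obtain ⟨j, b, hb⟩ := y
  by_cases h : i = j
  · subst h
    rcases le_total a b with h | h
    · exact Or.inl (Or.inr ⟨rfl, h⟩)
    · exact Or.inr (Or.inr ⟨rfl, h⟩)
  · rcases MonadicHeytingChain.total i j with h' | h'
    · exact Or.inl (Or.inl (lt_of_le_of_ne h' h))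
    · exact Or.inr (Or.inl (lt_of_le_of_ne h' (Ne.symm h)))

/-- The lexicographic total order of `C_I`; it provides the lattice operations `⊔`, `⊓`. -/
noncomputable instance : LinearOrder S.Sum where
  le := Sum.Le
  le_refl _ := Or.inr ⟨rfl, le_rfl⟩
  le_trans := Sum.le_trans'
  le_antisymm := Sum.le_antisymm'
  le_total := Sum.le_total'
  toDecidableLE := Classical.decRel _

/-- The constant `(1, 1)`. -/
instance : One S.Sum := ⟨⟨⊤, 1, Or.inl rfl⟩⟩

/-- The constant `(0, 0)`. -/
noncomputable instance : Bot S.Sum :=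
  ⟨⟨⊥, S.exists_bot.choose, S.exists_bot.choose_spec.1⟩⟩

theorem mul_mem {i : I} {a b : S.H i} (ha : a ∈ S.C i) : a * b ∈ S.C i :=
  ha.imp id fun ha h => ha (WajsbergHoopChain.left_eq_one h)

theorem cast_mem {i j : I} (h : i = j) {a : S.H i} (ha : a ∈ S.C i) : h ▸ a ∈ S.C j := by
  subst h; exact ha

open Classical in
/-- `(i, a) * (j, b)` is `(i, a)` if `i < j`, `(i, a * b)` if `i = j`, and `(j, b)` if `i > j`. -/
noncomputable instance : Mul S.Sum where
  mul x y :=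
    if x.idx < y.idx then x
    else if h : x.idx = y.idx then
      ⟨y.idx, (h ▸ x.val) * y.val, mul_mem (cast_mem h x.mem)⟩
    else y

theorem himp_mem {x y : S.Sum} (hle : ¬ x ≤ y) (h : x.idx = y.idx) :
    (h ▸ x.val) ⇨ y.val ∈ S.C y.idx :=
  Or.inr fun hc => hle (Or.inr ⟨h, hc⟩)

open Classical in
/-- `(i, a) ⇨ (j, b)` is `(1, 1)` if `(i, a) ≤ (j, b)`, `(i, a ⇨ b)` if `i = j` and `a > b`, and
`(j, b)` if `i > j`. -/
noncomputable instance : HImp S.Sum where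
  himp x y :=
    if hle : x ≤ y then 1
    else if h : x.idx = y.idx then
      ⟨y.idx, (h ▸ x.val) ⇨ y.val, himp_mem hle h⟩
    else y

theorem lt_qE_of_notMem {i : I} (h : i ∉ Set.range (qA : I → I)) : i < qE i :=
  lt_of_le_of_ne (le_qE i) fun he => h ⟨qE i, by rw [qA_qE, ← he]⟩

theorem qA_lt_of_notMem {i : I} (h : i ∉ Set.range (qA : I → I)) : qA i < i :=
  lt_of_le_of_ne (qA_le i) fun he => h ⟨i, he⟩

open Classical in
/-- `∃(i, a)` is `(i, a)` if `i ∈ ∀I`, and `(∃i, 0)` with `0` the least element of `C_{∃i}`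
otherwise. -/
noncomputable def qE (x : S.Sum) : S.Sum :=
  if h : x.idx ∈ Set.range (MonadicHeytingAlgebra.qA : I → I) then x
  else
    ⟨MonadicHeytingAlgebra.qE x.idx,
      (S.exists_least x.idx (lt_qE_of_notMem h)).choose,
      (S.exists_least x.idx (lt_qE_of_notMem h)).choose_spec.1⟩

open Classical in
/-- `∀(i, a)` is `(i, a)` if `i ∈ ∀I`, and `(∀i, u)` with `u` the greatest element of `C_{∀i}`
otherwise. -/
noncomputable def qA (x : S.Sum) : S.Sum :=
  if h : x.idx ∈ Set.range (MonadicHeytingAlgebra.qA : I → I) then x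
  else
    ⟨MonadicHeytingAlgebra.qA x.idx,
      (S.exists_greatest x.idx (qA_lt_of_notMem h)).choose,
      (S.exists_greatest x.idx (qA_lt_of_notMem h)).choose_spec.1⟩

end Sum

/-- Isomorphisms, in the signature of monadic BL-algebras, from a monadic BL-algebra `A` onto
`C_I`. -/
structure Iso (A : Type u) [MonadicBLAlgebra A] (S : HoopFamily I) extends A ≃ S.Sum where
  map_sup : ∀ x y : A, toFun (x ⊔ y) = toFun x ⊔ toFun y
  map_inf : ∀ x y : A, toFun (x ⊓ y) = toFun x ⊓ toFun y
  map_mul : ∀ x y : A, toFun (x * y) = toFun x * toFun y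
  map_himp : ∀ x y : A, toFun (x ⇨ y) = toFun x ⇨ toFun y
  map_qE : ∀ x : A, toFun (MonadicBLAlgebra.qE x) = Sum.qE (toFun x)
  map_qA : ∀ x : A, toFun (MonadicBLAlgebra.qA x) = Sum.qA (toFun x)
  map_bot : toFun ⊥ = ⊥
  map_one : toFun 1 = 1

end HoopFamily

/-! In a BL-chain let `x` be below `y` when `x < y` and `y ⇨ x = x`. This relation is a strict weak
order (`Below.or`). Its incomparability classes are convex, each becomes a Wajsberg hoop once `1` is
adjoined (`Sim.himp_himp`), and between different classes `*` and `⇨` follow the ordinal sum rules.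
So the chain is the ordinal sum of its classes.

The quantifiers respect this decomposition because of `sim_qA` and `sim_qE`: an element in the same
class as `∀x` or `∃x`, if it is `x` itself, is fixed. Hence a class consists of fixed elements only
or contains none (`fixed_of_sim`). In the second case both quantifiers are constant on the class,
and since `∀` and `∃` are adjoint to the inclusion of the fixed elements, `∀x` is the greatest and
`∃x` the least element of its own class. The quantifiers thus descend to the chain of classes, which
becomes the monadic Heyting chain `I`. -/

namespace BLAlgebra

variable {A : Type u} [BLAlgebra A]

/-! ### Residuation in BL-algebras. -/

theorem le_one (x : A) : x ≤ 1 := one_eq_top (A := A) ▸ le_top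

theorem le_himp_iff_mul_le {x y z : A} : z ≤ x ⇨ y ↔ x * z ≤ y := (residuation x y z).symm

theorem himp_eq_one_iff {x y : A} : x ⇨ y = 1 ↔ x ≤ y := by
  rw [← mul_one x, residuation, mul_one]
  exact ⟨fun h => h.ge, fun h => le_antisymm (le_one _) h⟩

theorem mul_le_mul_of_le_left {x y : A} (h : x ≤ y) (z : A) : z * x ≤ z * y := by
  rw [residuation]
  exact h.trans ((residuation _ _ _).1 le_rfl)

theorem mul_le_mul_of_le {x y z w : A} (h : x ≤ y) (h' : z ≤ w) : x * z ≤ y * w := by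
  refine (mul_le_mul_of_le_left h' x).trans ?_
  rw [mul_comm x, mul_comm y]
  exact mul_le_mul_of_le_left h w

theorem mul_le_left (x y : A) : x * y ≤ x := by
  simpa using mul_le_mul_of_le_left (le_one y) x

theorem mul_le_right (x y : A) : x * y ≤ y := mul_comm x y ▸ mul_le_left y x

theorem mul_himp_le (x y : A) : x * (x ⇨ y) ≤ y := (residuation _ _ _).2 le_rfl

theorem le_himp (x y : A) : y ≤ x ⇨ y := (residuation _ _ _).1 (mul_le_right x y)

theorem le_himp_himp (x y : A) : x ≤ (x ⇨ y) ⇨ y := by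
  rw [le_himp_iff_mul_le, mul_comm]; exact mul_himp_le x y

theorem mul_himp (x y z : A) : (x * y) ⇨ z = x ⇨ (y ⇨ z) := by
  refine eq_of_forall_le_iff fun w => ?_
  rw [le_himp_iff_mul_le, le_himp_iff_mul_le, le_himp_iff_mul_le, ← mul_assoc, mul_comm x y]

theorem himp_left_comm (x y z : A) : x ⇨ (y ⇨ z) = y ⇨ (x ⇨ z) := by
  rw [← mul_himp, mul_comm, mul_himp]

theorem himp_anti_left {x y : A} (h : x ≤ y) (z : A) : y ⇨ z ≤ x ⇨ z := by
  rw [le_himp_iff_mul_le]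
  exact (mul_le_mul_of_le h le_rfl).trans (mul_himp_le y z)

theorem himp_himp_himp (x y : A) : ((x ⇨ y) ⇨ y) ⇨ y = x ⇨ y :=
  le_antisymm (himp_anti_left (le_himp_himp x y) y) (le_himp_himp (x ⇨ y) y)

theorem one_himp (x : A) : (1 : A) ⇨ x = x :=
  le_antisymm (by simpa using mul_himp_le (1 : A) x) (le_himp 1 x)

theorem mul_himp_of_le {x y : A} (h : y ≤ x) : x * (x ⇨ y) = y := by
  rw [← divisibility, inf_eq_right.2 h]

/-! ### The relation between Wajsberg components. -/

/-- `Below x y` says that `x` lies in a strictly lower Wajsberg component than `y`. -/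
def Below (x y : A) : Prop := x < y ∧ y ⇨ x = x

/-- `Sim x y` says that `x` and `y` lie in the same Wajsberg component. -/
def Sim (x y : A) : Prop := ¬ Below x y ∧ ¬ Below y x

theorem Below.mul_eq {x y : A} (h : Below x y) : x * y = x := by
  have := mul_himp_of_le h.1.le
  rwa [h.2, mul_comm] at this

theorem Below.trans_le {x y z : A} (h : Below x y) (h' : y ≤ z) : Below x z :=
  ⟨h.1.trans_le h', le_antisymm ((himp_anti_left h' x).trans h.2.le) (le_himp z x)⟩

theorem not_below_of_le {x y : A} (h : y ≤ x) : ¬ Below x y := fun h' => h'.1.not_ge h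

theorem below_one {x : A} (h : x ≠ 1) : Below x 1 := ⟨lt_of_le_of_ne (le_one x) h, one_himp x⟩

theorem Sim.refl (x : A) : Sim x x := ⟨not_below_of_le le_rfl, not_below_of_le le_rfl⟩

theorem Sim.symm {x y : A} (h : Sim x y) : Sim y x := ⟨h.2, h.1⟩

theorem Sim.eq_one {x : A} (h : Sim x 1) : x = 1 := by_contra fun hx => h.1 (below_one hx)

theorem sim_himp {x y : A} (h : ¬ x ≤ y) : Sim (x ⇨ y) y := by
  refine ⟨not_below_of_le (le_himp x y), fun hb => h ?_⟩
  exact (le_himp_himp x y).trans hb.2.le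

theorem Sim.of_le_of_le {x y z : A} (h : Sim x z) (hxy : x ≤ y) (hyz : y ≤ z) : Sim x y :=
  ⟨fun hb => h.1 (hb.trans_le hyz), not_below_of_le hxy⟩

theorem below_of_lt {x y : A} (h : x < y) (hs : ¬ Sim x y) : Below x y :=
  by_contra fun hb => hs ⟨hb, not_below_of_le h.le⟩

section Chain

variable [Std.Total (α := A) (· ≤ ·)]

noncomputable instance : LinearOrder A :=
  { (inferInstance : Lattice A) with
    le_total := fun x y => Std.Total.total x y
    toDecidableLE := Classical.decRel _
    min_def := fun x y => by
      split_ifs with h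
      · exact inf_eq_left.2 h
      · exact inf_eq_right.2 ((Std.Total.total x y).resolve_left h)
    max_def := fun x y => by
      split_ifs with h
      · exact sup_eq_right.2 h
      · exact sup_eq_left.2 ((Std.Total.total x y).resolve_left h) }

theorem Below.le_trans {w x y : A} (h : Below x y) (hw : w ≤ x) : Below w y := by
  refine ⟨hw.trans_lt h.1, ?_⟩
  have hy := mul_himp_of_le (hw.trans h.1.le)
  -- Multiplication by `y` fixes everything under `x`. So `y ⇨ w ≤ x` gives `y ⇨ w = y * (y ⇨ w) =
  -- w`, and otherwise `x = y * x ≤ w`.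
  rcases le_total (y ⇨ w) x with ht | ht
  · rwa [← mul_himp_of_le ht, ← mul_assoc, mul_comm y, h.mul_eq, mul_himp_of_le ht] at hy
  · have : x = w := by
      refine le_antisymm ?_ hw
      calc x = y * x := by rw [mul_comm, h.mul_eq]
        _ ≤ y * (y ⇨ w) := mul_le_mul_of_le_left ht y
        _ = w := hy
    rw [← this, h.2]

/-- Negative transitivity: `Below` is a strict weak order. -/
theorem Below.or {x z : A} (h : Below x z) (y : A) : Below x y ∨ Below y z := by
  rcases le_or_gt y x with hyx | hxy
  · exact Or.inr (h.le_trans hyx)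
  -- The closure `(y ⇨ x) ⇨ x` of `y` has the same residual into `x` as `y`, and `z ⇨ ·` fixes it
  -- because `z ⇨ x = x`. Its position relative to `z` decides the alternative.
  rcases lt_or_ge ((y ⇨ x) ⇨ x) z with hw | hw
  · right
    refine Below.le_trans ⟨hw, ?_⟩ (le_himp_himp y x)
    rw [himp_left_comm, h.2]
  · left
    refine ⟨hxy, le_antisymm ?_ (le_himp y x)⟩
    rw [← himp_himp_himp]
    exact (himp_anti_left hw x).trans h.2.le

theorem Sim.trans {x y z : A} (h : Sim x y) (h' : Sim y z) : Sim x z :=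
  ⟨fun hb => (hb.or y).elim h.1 h'.1, fun hb => (hb.or y).elim h'.2 h.2⟩

theorem Sim.below_left {x y z : A} (h : Sim x y) (hb : Below x z) : Below y z :=
  (hb.or y).resolve_left h.1

theorem Sim.below_right {x y z : A} (h : Sim x y) (hb : Below z x) : Below z y :=
  (hb.or y).resolve_right h.2

theorem Sim.mul {x y : A} (h : Sim x y) : Sim (x * y) x := by
  refine ⟨fun hb => ?_, not_below_of_le (mul_le_left x y)⟩
  have hy := (h.below_right hb).2
  have : x ≤ x * y := by rw [← hy, le_himp_iff_mul_le, mul_comm]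
  exact hb.1.not_ge this

/-- This is the Wajsberg law within a component, the case `x ≤ y` being enough in a chain. -/
theorem Sim.himp_himp {x y : A} (h : Sim x y) (hxy : x ≤ y) : (y ⇨ x) ⇨ x = y := by
  rcases hxy.eq_or_lt with rfl | hlt
  · rw [himp_eq_one_iff.2 le_rfl, one_himp]
  refine ((le_himp_himp y x).eq_or_lt.resolve_right fun hw => ?_).symm
  set w := (y ⇨ x) ⇨ x with hwdef
  have hu : w ⇨ x = y ⇨ x := himp_himp_himp y x
  -- Here `y = w * (w ⇨ y)`. If `y ⇨ x < w ⇨ y`, this equation puts the component of `x` and `y`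
  -- below `w ⇨ y`, which forces `w ≤ y`. Otherwise it says `y ⇨ x = 1`.
  have ht : (w ⇨ y) ⇨ (y ⇨ x) = y ⇨ x := by
    conv_rhs => rw [← mul_himp_of_le hw.le, mul_comm, mul_himp, hu]
  rcases lt_or_ge (y ⇨ x) (w ⇨ y) with hlt' | hge
  · have hb : Below x (w ⇨ y) := Below.le_trans ⟨hlt', ht⟩ (le_himp y x)
    have hy := (h.below_left hb).2
    exact hw.not_ge ((le_himp_himp w y).trans hy.le)
  · rw [himp_eq_one_iff.2 hge] at ht
    exact hlt.not_ge (himp_eq_one_iff.1 ht.symm)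

/-! ### The chain of components. -/

variable (A) in
/-- Lying in the same Wajsberg component. -/
def simSetoid : Setoid A := ⟨Sim, Sim.refl, Sim.symm, Sim.trans⟩

/-- The chosen representative of the Wajsberg component of `x`. -/
noncomputable def rep (x : A) : A := (Quotient.mk (simSetoid A) x).out

theorem rep_sim (x : A) : Sim (rep x) x := Quotient.mk_out (s := simSetoid A) x

theorem rep_eq_rep_iff {x y : A} : rep x = rep y ↔ Sim x y := by
  refine ⟨fun h => (rep_sim x).symm.trans (h ▸ rep_sim y), fun h => ?_⟩
  unfold rep
  rw [Quotient.sound (s := simSetoid A) h]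

theorem rep_rep (x : A) : rep (rep x) = rep x := rep_eq_rep_iff.2 (rep_sim x)

theorem rep_lt_rep_iff {x y : A} : rep x < rep y ↔ Below x y := by
  constructor
  · intro h
    have hs : ¬ Sim (rep x) (rep y) := fun hs => by
      have := rep_eq_rep_iff.2 hs
      rw [rep_rep, rep_rep] at this
      exact h.ne this
    exact (rep_sim y).below_right ((rep_sim x).below_left (below_of_lt h hs))
  · intro h
    exact ((rep_sim x).symm.below_left ((rep_sim y).symm.below_right h)).1

theorem rep_mono {x y : A} (h : x ≤ y) : rep x ≤ rep y :=
  not_lt.1 fun h' => not_below_of_le h (rep_lt_rep_iff.1 h')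

variable (A) in
/-- The index set of the decomposition into Wajsberg components: the chosen representatives. -/
def Index : Type u := {x : A // rep x = x}

namespace Index

noncomputable instance : LinearOrder (Index A) := inferInstanceAs (LinearOrder {x : A // rep x = x})

/-- The index of the component of `x`. -/
noncomputable def of (x : A) : Index A := ⟨rep x, rep_rep x⟩

theorem of_val (i : Index A) : of i.1 = i := Subtype.ext i.2

theorem of_eq_of_iff {x y : A} : of x = of y ↔ Sim x y := Subtype.ext_iff.trans rep_eq_rep_iff

theorem of_lt_of_iff {x y : A} : of x < of y ↔ Below x y := rep_lt_rep_iff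

theorem of_mono {x y : A} (h : x ≤ y) : of x ≤ of y := rep_mono h

noncomputable instance : BoundedOrder (Index A) where
  top := of 1
  bot := of ⊥
  le_top i := by rw [← of_val i]; exact of_mono (le_one _)
  bot_le i := by rw [← of_val i]; exact of_mono bot_le

theorem of_one : of (1 : A) = ⊤ := rfl

theorem of_bot : of (⊥ : A) = ⊥ := rfl

theorem of_eq_top_iff {x : A} : of x = ⊤ ↔ x = 1 :=
  ⟨fun h => Sim.eq_one (of_eq_of_iff.1 h), fun h => h ▸ rfl⟩

/-! ### Components as Wajsberg hoops. -/

/-- The Wajsberg component with index `i`, with the unit added. -/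
@[ext]
structure Component (i : Index A) where
  val : A
  mem : val = 1 ∨ of val = i

namespace Component

variable {i : Index A}

noncomputable instance : One (Component i) := ⟨⟨1, Or.inl rfl⟩⟩

noncomputable instance : Mul (Component i) :=
  ⟨fun a b => ⟨a.1 * b.1, by
    rcases a.2 with ha | ha
    · rw [ha, one_mul]; exact b.2
    rcases b.2 with hb | hb
    · rw [hb, mul_one]; exact a.2
    · exact Or.inr ((of_eq_of_iff.2 (of_eq_of_iff.1 (ha.trans hb.symm)).mul).trans ha)⟩⟩

noncomputable instance : HImp (Component i) :=
  ⟨fun a b => ⟨a.1 ⇨ b.1, by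
    by_cases h : a.1 ≤ b.1
    · exact Or.inl (himp_eq_one_iff.2 h)
    rcases b.2 with hb | hb
    · exact absurd ((le_one _).trans_eq hb.symm) h
    · exact Or.inr ((of_eq_of_iff.2 (sim_himp h)).trans hb)⟩⟩

theorem val_mul (a b : Component i) : (a * b).1 = a.1 * b.1 := rfl

theorem val_himp (a b : Component i) : (a ⇨ b).1 = a.1 ⇨ b.1 := rfl

theorem val_wajsberg (a b : Component i) (h : a.1 ≤ b.1) :
    (a.1 ⇨ b.1) ⇨ b.1 = (b.1 ⇨ a.1) ⇨ a.1 := by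
  rw [himp_eq_one_iff.2 h, one_himp]
  rcases b.2 with hb | hb
  · rw [hb, one_himp, himp_eq_one_iff.2 le_rfl]
  rcases a.2 with ha | ha
  · rw [ha] at h ⊢
    rw [himp_eq_one_iff.2 (le_one _)]
    exact le_antisymm (le_one _) h
  · exact ((of_eq_of_iff.1 (ha.trans hb.symm)).himp_himp h).symm

noncomputable instance : WajsbergHoopChain (Component i) where
  mul_assoc a b c := Component.ext (mul_assoc a.1 b.1 c.1)
  one_mul a := Component.ext (one_mul a.1)
  mul_one a := Component.ext (mul_one a.1)
  mul_comm a b := Component.ext (mul_comm a.1 b.1)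
  himp_self a := Component.ext (himp_eq_one_iff.2 le_rfl)
  mul_himp a b c := Component.ext (BLAlgebra.mul_himp a.1 b.1 c.1)
  div_comm a b := Component.ext (by simp only [val_mul, val_himp, ← divisibility, inf_comm])
  wajsberg a b := Component.ext (by
    rcases le_total a.1 b.1 with h | h
    · exact val_wajsberg a b h
    · exact (val_wajsberg b a h).symm)
  total a b := (le_total a.1 b.1).imp (fun h => Component.ext (himp_eq_one_iff.2 h))
    fun h => Component.ext (himp_eq_one_iff.2 h)

theorem le_iff {a b : Component i} : a ≤ b ↔ a.1 ≤ b.1 :=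
  Component.ext_iff.trans himp_eq_one_iff

end Component

end Index

end Chain

end BLAlgebra

/-! ### Quantifiers and components. -/

namespace MonadicBLAlgebra

open BLAlgebra

variable {A : Type u} [MonadicBLAlgebra A]

theorem qA_le (x : A) : qA x ≤ x := himp_eq_one_iff.1 (m1 x)

theorem qA_one : qA (1 : A) = 1 := by
  have := m3 (1 : A) 1
  rwa [himp_eq_one_iff.2 (le_one _), himp_eq_one_iff.2 le_rfl] at this

theorem qA_mono {x y : A} (h : x ≤ y) : qA x ≤ qA y := by
  have := m3 x y
  rw [himp_eq_one_iff.2 ((qA_le x).trans h), qA_one] at this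
  exact himp_eq_one_iff.1 this.symm

theorem qA_qA (x : A) : qA (qA x) = qA x := by
  refine le_antisymm (qA_le _) ?_
  have := m3 x (qA x)
  rw [himp_eq_one_iff.2 le_rfl, qA_one] at this
  exact himp_eq_one_iff.1 this.symm

theorem qA_bot : qA (⊥ : A) = ⊥ := le_bot_iff.1 (qA_le ⊥)

theorem qA_qE (x : A) : qA (qE x) = qE x := by
  have := m4 x ⊥
  rwa [qA_bot, sup_bot_eq] at this

/-- By `m2`, `∃x ⇨ k = ∀(x ⇨ k)`, and `∀z = 1` exactly when `z = 1`. -/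
theorem qE_le_iff {x k : A} (hk : qA k = k) : qE x ≤ k ↔ x ≤ k := by
  have := m2 x k
  rw [hk] at this
  rw [← himp_eq_one_iff, ← himp_eq_one_iff, ← this]
  exact ⟨fun h => le_antisymm (le_one _) (h ▸ qA_le _), fun h => by rw [h, qA_one]⟩

theorem le_qE (x : A) : x ≤ qE x := (qE_le_iff (qA_qE x)).1 le_rfl

theorem qE_mono {x y : A} (h : x ≤ y) : qE x ≤ qE y :=
  (qE_le_iff (qA_qE y)).2 (h.trans (le_qE y))

theorem le_qA_iff {x k : A} (hk : qA k = k) : k ≤ qA x ↔ k ≤ x :=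
  ⟨fun h => h.trans (qA_le x), fun h => hk ▸ qA_mono h⟩

theorem qE_eq_self {k : A} (hk : qA k = k) : qE k = k :=
  le_antisymm ((qE_le_iff hk).2 le_rfl) (le_qE k)

theorem qA_mul_of_fixed {k l : A} (hk : qA k = k) (hl : qA l = l) : qA (k * l) = k * l := by
  refine le_antisymm (qA_le _) ?_
  have h := m3 k (k * l)
  rw [hk] at h
  rw [← le_himp_iff_mul_le, ← h, le_qA_iff hl, le_himp_iff_mul_le]

section Chain

variable [Std.Total (α := A) (· ≤ ·)]

theorem below_mul_self {x y : A} (h : Below x y) : Below x (y * y) :=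
  (Sim.refl y).mul.symm.below_right h

/-- The Wajsberg law turns `m2` for `x ⇨ ∀x` into `∀x = ∃(x ⇨ ∀x) ⇨ ∀x`. -/
theorem below_qE_himp {x : A} (hx : qA x ≠ x) (hs : Sim (qA x) x) :
    Below (qA x) (qE (x ⇨ qA x)) := by
  have hn : ¬ x ≤ qA x := fun h => hx (le_antisymm (qA_le x) h)
  have h := m2 (x ⇨ qA x) x
  rw [hs.himp_himp (qA_le x)] at h
  refine ⟨((le_himp x _).trans (le_qE _)).lt_of_ne fun he => ?_, h.symm⟩
  rw [← he, himp_eq_one_iff.2 le_rfl] at h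
  exact hn (h ▸ le_one x)

theorem not_himp_le {x : A} (hx : qA x ≠ x) (hs : Sim (qA x) x) : ¬ x ⇨ qA x ≤ x := by
  intro h
  have h2 : (x ⇨ qA x) * (x ⇨ qA x) ≤ qA x :=
    (mul_le_mul_of_le h le_rfl).trans (mul_himp_le _ _)
  rw [← qE_le_iff (qA_qA x), m5] at h2
  exact not_below_of_le h2 (below_mul_self (below_qE_himp hx hs))

theorem sim_qA {x : A} (hs : Sim (qA x) x) : qA x = x := by
  by_contra hx
  have hn : ¬ x ≤ qA x := fun h => hx (le_antisymm (qA_le x) h)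
  set y := x ⇨ qA x with hy
  have hb := below_qE_himp hx hs
  have hys : Sim y (qA x) := sim_himp hn
  have hay : qA x ≤ qA y := (le_qA_iff (qA_qA x)).2 (le_himp _ _)
  have hsy : Sim (qA x) (qA y) := hys.symm.of_le_of_le hay (qA_le y)
  have hsy' : Sim (qA y) y := hsy.symm.trans hys.symm
  have hyne : qA y ≠ y := fun h => hys.2 (by rwa [← hy, qE_eq_self h] at hb)
  -- `y` satisfies the same assumptions as `x` did, so `not_himp_le` applies to it and gives `y ≤ y
  -- ⇨ ∀y`. By `m5`, `∃y * ∃y ≤ ∀y`, although `∀y` lies in the component of `∀x`, which is below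
  -- that of `∃y`.
  have h2 : y * y ≤ qA y :=
    (mul_le_mul_of_le_left (le_of_not_ge (not_himp_le hyne hsy')) y).trans (mul_himp_le _ _)
  rw [← qE_le_iff (qA_qA y), m5] at h2
  exact not_below_of_le h2 (below_mul_self (hsy.below_left hb))

theorem sim_qE {x : A} (hs : Sim x (qE x)) : qA x = x := by
  by_contra hx
  have hn : ¬ qE x ≤ x := fun h => hx <| by
    have := le_antisymm h (le_qE x)
    rw [← this, qA_qE]
  set y := qE x ⇨ x with hy
  have hmul : qE x * y = x := mul_himp_of_le (le_qE x)
  have hfix := qA_mul_of_fixed (qA_qE x) (qA_qE y)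
  have hle : qE x ≤ qE x * qE y :=
    (qE_le_iff hfix).2 (hmul.ge.trans (mul_le_mul_of_le_left (le_qE y) _))
  -- If `y ≤ ∃x`, then `∃x` is idempotent, so `∃x ⇨ y = y` and `x ≤ y` drops below the component of
  -- `∃x`. If `∃x ≤ y`, the fixed element `∃x * ∃x` lies under `x` in the same component, which
  -- places `∀x` there too.
  rcases le_total y (qE x) with h | h
  · have hyE : qE y ≤ qE x := (qE_le_iff (qA_qE x)).2 h
    have h1 : qE x ≤ qE x * qE x := hle.trans (mul_le_mul_of_le_left hyE _)
    have hyy : qE x ⇨ y = y := by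
      rw [hy, ← mul_himp, le_antisymm (mul_le_left _ _) h1]
    rcases h.eq_or_lt with heq | hlt
    · rw [heq] at hmul
      exact hn (h1.trans hmul.le)
    · exact hs.1 (Below.le_trans ⟨hlt, hyy⟩ (le_himp _ _))
  · have h1 : qE x * qE x ≤ x := (mul_le_mul_of_le_left h _).trans hmul.le
    have h2 : qE x * qE x ≤ qA x :=
      (le_qA_iff (qA_mul_of_fixed (qA_qE x) (qA_qE x))).2 h1
    refine hx (sim_qA ?_)
    have h3 : Sim (qE x * qE x) x := (Sim.refl _).mul.trans hs.symm
    exact (h3.of_le_of_le h2 (qA_le x)).symm.trans h3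

/-- Either `x ≤ ∃x ≤ k` or `k ≤ ∀x ≤ x`, so convexity of components reduces this to `sim_qE` or
`sim_qA`. -/
theorem fixed_of_sim {x k : A} (hk : qA k = k) (hs : Sim x k) : qA x = x := by
  rcases le_total x k with h | h
  · exact sim_qE (hs.of_le_of_le (le_qE x) ((qE_le_iff hk).2 h))
  · have : k ≤ qA x := (le_qA_iff hk).2 h
    exact sim_qA ((hs.symm.of_le_of_le this (qA_le x)).symm.trans hs.symm)

/-- The fixed element `∀x` lies in a lower component, hence under `y` and so under `∀y`; the roles
are symmetric. -/
theorem qA_eq_of_sim {x y : A} (hs : Sim x y) (hx : qA x ≠ x) : qA x = qA y := by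
  have key : ∀ {x y : A}, Sim x y → qA x ≠ x → qA x ≤ qA y := fun {x y} hs hx => by
    have hn : ¬ Sim (qA x) x := fun h => hx (sim_qA h)
    have hb := below_of_lt (lt_of_le_of_ne (qA_le x) hx) hn
    exact (le_qA_iff (qA_qA x)).2 (hs.below_right hb).1.le
  exact le_antisymm (key hs hx) (key hs.symm fun hy => hx (fixed_of_sim hy hs))

theorem qE_eq_of_sim {x y : A} (hs : Sim x y) (hx : qA x ≠ x) : qE x = qE y := by
  have key : ∀ {x y : A}, Sim x y → qA x ≠ x → qE y ≤ qE x := fun {x y} hs hx => by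
    have hn : ¬ Sim x (qE x) := fun h => hx (sim_qE h)
    have hb := below_of_lt (lt_of_le_of_ne (le_qE x) fun h => hx (by rw [h, qA_qE])) hn
    exact (qE_le_iff (qA_qE x)).2 (hs.below_left hb).1.le
  exact le_antisymm (key hs.symm fun hy => hx (fixed_of_sim hy hs)) (key hs hx)

/-- `∀x` is the greatest element of its component if `x` is not fixed. -/
theorem le_qA_of_sim {x y : A} (hx : qA x ≠ x) (hs : Sim y (qA x)) : y ≤ qA x := by
  have hn : ¬ Sim (qA x) x := fun h => hx (sim_qA h)
  have hb := below_of_lt (lt_of_le_of_ne (qA_le x) hx) hn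
  exact (le_qA_iff (fixed_of_sim (qA_qA x) hs)).2 (hs.symm.below_left hb).1.le

/-- `∃x` is the least element of its component if `x` is not fixed. -/
theorem qE_le_of_sim {x y : A} (hx : qA x ≠ x) (hs : Sim y (qE x)) : qE x ≤ y := by
  have hn : ¬ Sim x (qE x) := fun h => hx (sim_qE h)
  have hb := below_of_lt (lt_of_le_of_ne (le_qE x) fun h => hx (by rw [h, qA_qE])) hn
  exact (qE_le_iff (fixed_of_sim (qA_qE x) hs)).2 (hs.symm.below_right hb).1.le

theorem sim_qA_of_sim {x y : A} (hs : Sim x y) : Sim (qA x) (qA y) := by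
  by_cases hx : qA x = x
  · rwa [hx, fixed_of_sim hx hs.symm]
  · rw [qA_eq_of_sim hs hx]
    exact Sim.refl _

theorem sim_qE_of_sim {x y : A} (hs : Sim x y) : Sim (qE x) (qE y) := by
  by_cases hx : qA x = x
  · rwa [qE_eq_self hx, qE_eq_self (fixed_of_sim hx hs.symm)]
  · rw [qE_eq_of_sim hs hx]
    exact Sim.refl _

end Chain

end MonadicBLAlgebra

/-! ### The monadic Heyting chain of indices and its hoops. -/

namespace BLAlgebra.Index

open MonadicBLAlgebra

variable {A : Type u} [MonadicBLAlgebra A] [Std.Total (α := A) (· ≤ ·)]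

/-- The quantifier `∀` on indices. -/
noncomputable def indexA (i : Index A) : Index A := of (qA i.1)

/-- The quantifier `∃` on indices. -/
noncomputable def indexE (i : Index A) : Index A := of (qE i.1)

theorem indexA_of (x : A) : indexA (of x) = of (qA x) :=
  of_eq_of_iff.2 (sim_qA_of_sim (rep_sim x))

theorem indexE_of (x : A) : indexE (of x) = of (qE x) :=
  of_eq_of_iff.2 (sim_qE_of_sim (rep_sim x))

theorem indexA_le (i : Index A) : indexA i ≤ i := (of_mono (qA_le i.1)).trans_eq (of_val i)

theorem le_indexE (i : Index A) : i ≤ indexE i := (of_val i).symm.trans_le (of_mono (le_qE i.1))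

theorem indexA_mono : Monotone (indexA (A := A)) := fun _ _ h => of_mono (qA_mono h)

theorem indexE_mono : Monotone (indexE (A := A)) := fun _ _ h => of_mono (qE_mono h)

theorem indexA_indexE (i : Index A) : indexA (indexE i) = indexE i := by
  rw [indexE, indexA_of, qA_qE]

theorem indexE_indexA (i : Index A) : indexE (indexA i) = indexA i := by
  rw [indexA, indexE_of, qE_eq_self (qA_qA _)]

theorem indexE_indexE (i : Index A) : indexE (indexE i) = indexE i :=
  (indexE_of _).trans (congrArg of (qE_eq_self (qA_qE _)))

theorem indexA_of_eq_iff {x : A} : indexA (of x) = of x ↔ qA x = x := by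
  rw [indexA_of, of_eq_of_iff]
  exact ⟨sim_qA, fun h => by rw [h]; exact Sim.refl x⟩

/-- On a chain, monotone maps preserve binary infima and suprema, so the quantifier laws for `⊓` and
`⊔` need only monotonicity and idempotence. -/
noncomputable instance : MonadicHeytingChain (Index A) where
  __ := LinearOrder.toBiheytingAlgebra (Index A)
  qE := indexE
  qA := indexA
  qA_le := indexA_le
  le_qE := le_indexE
  qA_inf a b := indexA_mono.map_inf a b
  qE_sup a b := indexE_mono.map_sup a b
  qA_top := by rw [← of_one, indexA_of, qA_one]
  qE_bot := by rw [← of_bot, indexE_of, qE_eq_self qA_bot]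
  qA_qE := indexA_indexE
  qE_qA := indexE_indexA
  qE_inf a b := (indexE_mono.map_inf (indexE a) b).trans (by rw [indexE_indexE])
  total := le_total

/-- This matches the case distinction `i ∈ ∀I` in the quantifiers of `C_I` with fixedness in `A`. -/
theorem mem_range_iff {x : A} :
    of x ∈ Set.range (MonadicHeytingAlgebra.qA : Index A → Index A) ↔ qA x = x := by
  rw [← indexA_of_eq_iff]
  refine ⟨?_, fun h => ⟨_, h⟩⟩
  rintro ⟨i, hi⟩
  rw [← hi]
  exact (indexA_of _).trans (congrArg of (qA_qA _))

/-- The element `x` in the component of index `of x`. -/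
noncomputable def Component.mk' (x : A) : Component (of x) := ⟨x, Or.inr rfl⟩

theorem of_val_of_mem {i : Index A} {a : Component i}
    (ha : a ∈ componentSet (Index A) Component i) :
    of a.val = i := by
  rcases ha with rfl | ha
  · rcases a.2 with h | h
    · rw [h, of_one]
    · exact h
  · exact a.2.resolve_left fun h => ha (Component.ext h)

theorem mem_componentSet_of_eq {i : Index A} {a : Component i} (ha : of a.val = i) :
    a ∈ componentSet (Index A) Component i := by
  by_cases h : a.val = 1
  · left
    rw [← ha, h, of_one]
  · exact Or.inr fun h' => h (congrArg Component.val h')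

theorem isLeast_qE {x : A} (hx : qA x ≠ x) :
    IsLeast (componentSet (Index A) Component (of (qE x))) (Component.mk' (qE x)) :=
  ⟨mem_componentSet_of_eq rfl, fun _ ha =>
    Component.le_iff.2 (qE_le_of_sim hx (of_eq_of_iff.1 (of_val_of_mem ha)))⟩

theorem isGreatest_qA {x : A} (hx : qA x ≠ x) :
    IsGreatest (componentSet (Index A) Component (of (qA x))) (Component.mk' (qA x)) :=
  ⟨mem_componentSet_of_eq rfl, fun _ ha =>
    Component.le_iff.2 (le_qA_of_sim hx (of_eq_of_iff.1 (of_val_of_mem ha)))⟩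

theorem isLeast_bot :
    IsLeast (componentSet (Index A) Component (of ⊥)) (Component.mk' (⊥ : A)) :=
  ⟨mem_componentSet_of_eq rfl, fun _ _ => Component.le_iff.2 bot_le⟩

variable (A) in
/-- The decomposition of a monadic BL-chain into Wajsberg hoops. -/
noncomputable def hoopFamily : HoopFamily (Index A) where
  H := Component
  subsingleton_top := ⟨fun a b => by
    have h : ∀ c : Component (⊤ : Index A), c.val = 1 := fun c =>
      c.2.elim id of_eq_top_iff.1
    exact Component.ext ((h a).trans (h b).symm)⟩
  nonempty i := ⟨⟨i.1, Or.inr (of_val i)⟩, mem_componentSet_of_eq (of_val i)⟩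
  exists_bot := ⟨_, isLeast_bot⟩
  exists_greatest i hi := ⟨_, isGreatest_qA (x := i.1) fun h =>
    hi.ne ((congrArg of h).trans (of_val i))⟩
  exists_least i hi := ⟨_, isLeast_qE (x := i.1) fun h =>
    hi.ne' ((congrArg of (qE_eq_self h)).trans (of_val i))⟩

/-! ### The isomorphism with the ordinal sum. -/

/-- The element of `A` given by an element of the ordinal sum. -/
def toElem (s : (hoopFamily A).Sum) : A := Component.val s.val

theorem of_toElem (s : (hoopFamily A).Sum) : of (toElem s) = s.idx := of_val_of_mem s.mem

theorem toElem_injective : Function.Injective (toElem (A := A)) := by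
  intro s t h
  have hi : s.idx = t.idx := by rw [← of_toElem, ← of_toElem, h]
  obtain ⟨i, a, ha⟩ := s
  obtain ⟨j, b, hb⟩ := t
  dsimp only at hi
  subst hi
  have : a = b := Component.ext h
  rw [HoopFamily.Sum.mk.injEq]
  exact ⟨rfl, heq_of_eq this⟩

/-- The element of the ordinal sum given by an element of `A`. -/
noncomputable def toSum (x : A) : (hoopFamily A).Sum :=
  ⟨of x, Component.mk' x, mem_componentSet_of_eq rfl⟩

theorem toElem_toSum (x : A) : toElem (toSum x) = x := rfl

theorem toSum_toElem (s : (hoopFamily A).Sum) : toSum (toElem s) = s :=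
  toElem_injective (toElem_toSum _)

theorem val_cast {i j : Index A} (h : i = j) (a : Component i) :
    (h ▸ a : Component j).val = a.val := by
  subst h; rfl

theorem toElem_le_iff {s t : (hoopFamily A).Sum} : toElem s ≤ toElem t ↔ s ≤ t := by
  constructor
  · intro h
    have hi := of_mono h
    rw [of_toElem, of_toElem] at hi
    rcases hi.eq_or_lt with hi | hi
    · exact Or.inr ⟨hi, Component.le_iff.2 ((val_cast hi s.val).trans_le h)⟩
    · exact Or.inl hi
  · rintro (h | ⟨h, hle⟩)
    · rw [← of_toElem s, ← of_toElem t, of_lt_of_iff] at h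
      exact h.1.le
    · exact (val_cast h s.val).symm.trans_le (Component.le_iff.1 hle)

/-- Distinct indices mean that one element is `Below` the other and absorbs it. -/
theorem toElem_mul (s t : (hoopFamily A).Sum) : toElem (s * t) = toElem s * toElem t := by
  change toElem (@ite _ _ (Classical.propDecidable _) _ _) = _
  split_ifs with h h'
  · rw [← of_toElem s, ← of_toElem t, of_lt_of_iff] at h
    exact h.mul_eq.symm
  · exact congrArg (· * toElem t) (val_cast h' s.val)
  · have h := lt_of_le_of_ne (not_lt.1 h) (Ne.symm h')
    rw [← of_toElem s, ← of_toElem t, of_lt_of_iff] at h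
    rw [mul_comm]
    exact h.mul_eq.symm

theorem toElem_himp (s t : (hoopFamily A).Sum) : toElem (s ⇨ t) = toElem s ⇨ toElem t := by
  change toElem (dite _ _ _) = _
  split_ifs with h h'
  · exact (himp_eq_one_iff.2 (toElem_le_iff.2 h)).symm
  · exact congrArg (· ⇨ toElem t) (val_cast h' s.val)
  · have h := lt_of_le_of_ne (not_lt.1 fun hlt => h (Or.inl hlt)) (Ne.symm h')
    rw [← of_toElem s, ← of_toElem t, of_lt_of_iff] at h
    exact h.2.symm

theorem toSum_mono : Monotone (toSum (A := A)) := fun _ _ h => toElem_le_iff.1 h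

theorem toSum_bot : toSum (⊥ : A) = ⊥ :=
  toElem_injective <| congrArg Component.val <|
    isLeast_bot.unique (hoopFamily A).exists_bot.choose_spec

theorem toElem_sumE (s : (hoopFamily A).Sum) : toElem s.qE = qE (toElem s) := by
  obtain ⟨x, rfl⟩ : ∃ x, s = toSum x := ⟨_, (toSum_toElem s).symm⟩
  -- The index `∃(of x)` equals `of (qE x)` only propositionally, so uniqueness of the least element
  -- is stated over a variable index.
  have hval : ∀ {i : Index A} {a : Component i}, i = of (qE x) → qA x ≠ x →
      IsLeast (componentSet (Index A) Component i) a → a.val = qE x := by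
    rintro _ a rfl hx ha
    exact congrArg Component.val (ha.unique (isLeast_qE hx))
  unfold HoopFamily.Sum.qE
  split_ifs with h
  · exact (qE_eq_self (mem_range_iff.1 h)).symm
  · exact hval (indexE_of x) (fun hx => h (mem_range_iff.2 hx))
      ((hoopFamily A).exists_least _ (HoopFamily.Sum.lt_qE_of_notMem h)).choose_spec

theorem toElem_sumA (s : (hoopFamily A).Sum) : toElem s.qA = qA (toElem s) := by
  obtain ⟨x, rfl⟩ : ∃ x, s = toSum x := ⟨_, (toSum_toElem s).symm⟩
  have hval : ∀ {i : Index A} {a : Component i}, i = of (qA x) → qA x ≠ x →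
      IsGreatest (componentSet (Index A) Component i) a → a.val = qA x := by
    rintro _ a rfl hx ha
    exact congrArg Component.val (ha.unique (isGreatest_qA hx))
  unfold HoopFamily.Sum.qA
  split_ifs with h
  · exact (mem_range_iff.1 h).symm
  · exact hval (indexA_of x) (fun hx => h (mem_range_iff.2 hx))
      ((hoopFamily A).exists_greatest _ (HoopFamily.Sum.qA_lt_of_notMem h)).choose_spec

variable (A) in
/-- Every totally ordered monadic BL-algebra is isomorphic to the ordinal sum of its components. -/
noncomputable def iso : HoopFamily.Iso A (hoopFamily A) where
  toFun := toSum
  invFun := toElem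
  left_inv := toElem_toSum
  right_inv := toSum_toElem
  map_sup := toSum_mono.map_sup
  map_inf := toSum_mono.map_inf
  map_mul x y := toElem_injective (toElem_mul (toSum x) (toSum y)).symm
  map_himp x y := toElem_injective (toElem_himp (toSum x) (toSum y)).symm
  map_qE x := toElem_injective (toElem_sumE (toSum x)).symm
  map_qA x := toElem_injective (toElem_sumA (toSum x)).symm
  map_bot := toSum_bot
  map_one := toElem_injective rfl

end BLAlgebra.Index

theorem mainTheorem2 {A : Type u} [MonadicBLChain A] :
    ∃ (I : Type u) (_ : MonadicHeytingChain I) (S : HoopFamily I),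
      Nonempty (HoopFamily.Iso A S) := by
  have : Std.Total (α := A) (· ≤ ·) := ⟨MonadicBLChain.total⟩
  exact ⟨BLAlgebra.Index A, inferInstance, BLAlgebra.Index.hoopFamily A,
    ⟨BLAlgebra.Index.iso A⟩⟩
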